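/- Call a partition $\lambda=\lambda_1+\lambda_2+\cdots+\lambda_\ell$ (with $\lambda_1\ge\lambda_2\ge\cdots\ge\lambda_\ell\ge 1$; the empty partition, $\ell=0$, is allowed) a partition of type II if $\lambda_i-\lambda_{i+2}\ge 3$ for all $1\le i\le \ell-2$, and, for all $1\le i\le \ell-1$, $\lambda_i-\lambda_{i+1}\le 1$ implies $\lambda_i+\lambda_{i+1}\equiv 2\pmod 3$. For a set $S$ of partitions let $G_S(x,q)=\sum_{\lambda\in S}x^{\sharp(\lambda)}q^{|\lambda|}$, where $\sharp(\lambda)$ is the number of parts and $|\lambda|$ the sum of the parts of $\lambda$, and let $(a;q)_n=\prod_{k=0}^{n-1}(1-aq^k)$. Let $G_{\mathrm{II},1}$ (resp. $G_{\mathrm{II},2}$) be the generating function $G_S$ of the set $S$ of type II partitions all of whose parts are at least $1$ (resp. $2$), and $G_{\mathrm{II},a}$ that of the set of type II partitions in which $1$ appears at most once; the empty partition belongs to all three sets. Then, as identities of formal power series in $x$ and $q$, $$G_{\mathrm{II},1}(x,q)=\sum_{n_1,n_2\ge 0}\frac{q^{n_1^2+3n_2^2+3n_1n_2-n_2}x^{n_1+2n_2}}{(q;q)_{n_1}(q^3;q^3)_{n_2}},$$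 $$G_{\mathrm{II},2}(x,q)=\sum_{n_1,n_2\ge 0}\frac{q^{n_1^2+3n_2^2+3n_1n_2+n_1+2n_2}x^{n_1+2n_2}}{(q;q)_{n_1}(q^3;q^3)_{n_2}},$$ $$G_{\mathrm{II},a}(x,q)=\sum_{n_1,n_2\ge 0}\frac{q^{n_1^2+3n_2^2+3n_1n_2+2n_2}x^{n_1+2n_2}}{(q;q)_{n_1}(q^3;q^3)_{n_2}}.$$ -/

import Mathlib

open scoped MvPowerSeries.WithPiTopology

namespace TypeIIPartitions

/-- The set of all integer partitions: pairs of a natural number `n = |λ|` and a partition of `n`.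
The empty partition is the unique partition of `0`. -/
abbrev Ptn : Type := Σ n : ℕ, n.Partition

/-- The number of parts `♯(λ)`. -/
def numParts (p : Ptn) : ℕ := p.2.parts.card

/-- The parts `λ₁ ≥ λ₂ ≥ ⋯ ≥ λ_ℓ` in weakly decreasing order (the list is indexed from `0`). -/
def partsList (p : Ptn) : List ℕ := p.2.parts.sort (· ≥ ·)

/-- Type II partitions: `λ_i - λ_{i+2} ≥ 3` for all `i` (difference at least `3` at distance `2`),
and whenever `λ_i - λ_{i+1} ≤ 1`, the sum `λ_i + λ_{i+1}` is congruent to `2` modulo `3`. -/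
def IsTypeII (p : Ptn) : Prop :=
  (∀ (i : ℕ) (h : i + 2 < (partsList p).length),
    (partsList p)[i + 2] + 3 ≤ (partsList p)[i]) ∧
  (∀ (i : ℕ) (h : i + 1 < (partsList p).length),
    (partsList p)[i] ≤ (partsList p)[i + 1] + 1 →
      (partsList p)[i] + (partsList p)[i + 1] ≡ 2 [MOD 3])

/-- Type II partitions whose smallest part is at least `k`
(including, as is customary, the empty partition). -/
def typeIISmallestGe (k : ℕ) : Set Ptn :=
  {p | IsTypeII p ∧ ∀ a ∈ p.2.parts, k ≤ a}

/-- Type II partitions in which `1` appears at most once. -/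
def typeIIOneAtMostOnce : Set Ptn :=
  {p | IsTypeII p ∧ p.2.parts.count 1 ≤ 1}

/-- The ring `ℤ⟦x, q⟧` of formal power series in two variables. -/
abbrev Series : Type := MvPowerSeries (Fin 2) ℤ

/-- The variable `x`, which marks the number of parts. -/
noncomputable def x : Series := MvPowerSeries.X 0

/-- The variable `q`, which marks the sum of the parts. -/
noncomputable def q : Series := MvPowerSeries.X 1

/-- The bivariate generating function `G_S(x, q) = ∑_{λ ∈ S} x^{♯(λ)} q^{|λ|}`: the coefficient of
`x^m q^n` is the number of partitions of `n` in `S` with exactly `m` parts. -/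
noncomputable def genFun (S : Set Ptn) : Series := fun e =>
  (Set.ncard {p : Ptn | p ∈ S ∧ numParts p = e 0 ∧ p.1 = e 1} : ℤ)

/-- The coefficientwise definition of `genFun` agrees with the sum over `S`. -/
theorem hasSum_genFun (S : Set Ptn) :
    HasSum (fun p : S => x ^ numParts p.1 * q ^ p.1.1) (genFun S) := by
  classical
  rw [MvPowerSeries.WithPiTopology.hasSum_iff_hasSum_coeff]
  intro e
  have hfin : {p : Ptn | p ∈ S ∧ numParts p = e 0 ∧ p.1 = e 1}.Finite := by
    refine (Set.finite_range (fun r : (e 1).Partition => (⟨e 1, r⟩ : Ptn))).subset ?_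
    rintro ⟨n, r⟩ ⟨-, -, h⟩
    obtain rfl : n = e 1 := h
    exact ⟨r, rfl⟩
  have hmon : ∀ m n : ℕ, x ^ m * q ^ n = MvPowerSeries.monomial
      (Finsupp.single 0 m + Finsupp.single 1 n) (1 : ℤ) := by
    intro m n
    simp [x, q, MvPowerSeries.X_pow_eq, MvPowerSeries.monomial_mul_monomial]
  have hcoef : ∀ p : Ptn, MvPowerSeries.coeff e (x ^ numParts p * q ^ p.1) =
      if numParts p = e 0 ∧ p.1 = e 1 then (1 : ℤ) else 0 := by
    intro p
    rw [hmon, MvPowerSeries.coeff_monomial]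
    congr 1
    rw [Finsupp.ext_iff]
    simp [Fin.forall_fin_two, eq_comm]
  simp only [hcoef]
  have hval : MvPowerSeries.coeff e (genFun S) =
      ∑ p ∈ hfin.toFinset, if numParts p = e 0 ∧ p.1 = e 1 then (1 : ℤ) else 0 := by
    have h1 : MvPowerSeries.coeff e (genFun S) =
      (Set.ncard {p : Ptn | p ∈ S ∧ numParts p = e 0 ∧ p.1 = e 1} : ℤ) := rfl
    rw [h1, Set.ncard_eq_toFinset_card _ hfin, Finset.sum_congr rfl (g := fun _ => (1 : ℤ))]
    · simp
    · intro p hp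
      rw [Set.Finite.mem_toFinset] at hp
      exact if_pos hp.2
  rw [hval]
  have key : HasSum (S.indicator fun p : Ptn =>
      if numParts p = e 0 ∧ p.1 = e 1 then (1 : ℤ) else 0)
      (∑ p ∈ hfin.toFinset, if numParts p = e 0 ∧ p.1 = e 1 then (1 : ℤ) else 0) := by
    have h2 : (∑ p ∈ hfin.toFinset, if numParts p = e 0 ∧ p.1 = e 1 then (1 : ℤ) else 0) =
        ∑ p ∈ hfin.toFinset, S.indicator (fun p : Ptn =>
          if numParts p = e 0 ∧ p.1 = e 1 then (1 : ℤ) else 0) p := by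
      refine Finset.sum_congr rfl fun p hp => ?_
      rw [Set.Finite.mem_toFinset] at hp
      rw [Set.indicator_of_mem hp.1]
    rw [h2]
    refine hasSum_sum_of_ne_finset_zero fun p hp => ?_
    rw [Set.Finite.mem_toFinset] at hp
    by_cases hS : p ∈ S
    · rw [Set.indicator_of_mem hS, if_neg fun h => hp ⟨hS, h⟩]
    · exact Set.indicator_of_notMem hS _
  exact (hasSum_subtype_iff_indicator (s := S)).2 key

/-- The `q`-Pochhammer symbol `(a; b)_n = ∏_{k=0}^{n-1} (1 - a b^k)`. -/
noncomputable def qPoch (a b : Series) (n : ℕ) : Series :=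
  ∏ k ∈ Finset.range n, (1 - a * b ^ k)

/-- The inverse in `ℤ⟦x, q⟧` of a power series with constant coefficient `1`. -/
noncomputable def inv (f : Series) : Series := MvPowerSeries.invOfUnit f 1

/-- The denominators `(q; q)_{n₁} (q³; q³)_{n₂}` are indeed inverted by `inv`. -/
theorem denom_mul_inv (n₁ n₂ : ℕ) :
    (qPoch q q n₁ * qPoch (q ^ 3) (q ^ 3) n₂) *
      inv (qPoch q q n₁ * qPoch (q ^ 3) (q ^ 3) n₂) = 1 := by
  apply MvPowerSeries.mul_invOfUnit
  simp [qPoch, q, map_prod]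

/-- The summand
`q^{n₁² + 3n₂² + 3n₁n₂ + L(n₁,n₂)} x^{n₁ + 2n₂} / ((q;q)_{n₁} (q³;q³)_{n₂})`,
with the whole exponent `E` of `q` as an argument. -/
noncomputable def summand (E : ℕ → ℕ → ℕ) (n : ℕ × ℕ) : Series :=
  q ^ E n.1 n.2 * x ^ (n.1 + 2 * n.2) *
    inv (qPoch q q n.1 * qPoch (q ^ 3) (q ^ 3) n.2)

/-- The subtraction in the exponent `n₁² + 3n₂² + 3n₁n₂ - n₂` never truncates. -/
theorem le_exponent (n₁ n₂ : ℕ) : n₂ ≤ n₁ ^ 2 + 3 * n₂ ^ 2 + 3 * n₁ * n₂ := by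
  nlinarith [Nat.le_self_pow two_ne_zero n₂, Nat.zero_le (n₁ ^ 2), Nat.zero_le (n₁ * n₂)]

end TypeIIPartitions

namespace TypeIIPartitions

/-! ### The double sums -/

/-! Write S(a, b) for `doubleSum a b`; the three claims concern S(0, 0), S(1, 3) and S(0, 3). Both
sides satisfy the same system of three linear recurrences, and this system has only one solution.

On the partition side, the type II condition is invariant under adding 3 to every part. Removing the
parts in {3k+1, 3k+2, 3k+3} leaves a type II partition with parts above 3k+3, and the removed block
restricts the rest only by bounding the multiplicity of 3k+4 by 0, 1 or 2 (`levelSet_eq`). So the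
generating functions of `levelSet k c`, for c = 2, 1, 0, are combinations of those at level k+1.

On the series side, adding 3 to every part is x → xq³, that is (a, b) → (a+3, b+6). The relations
`doubleSum_sub_left` and `doubleSum_sub_right` yield the same system for S(3k, 6k), S(3k, 6k+3) and
S(3k+1, 6k+3).

At level k all these series are 1 modulo q^(3k). Descending from a high level to k = 0 gives
agreement modulo every power of q. -/

/-- The exponent `n₁² + 3n₂² + 3n₁n₂ - n₂ + a n₁ + b n₂`. -/
def expo (a b n₁ n₂ : ℕ) : ℕ := n₁ ^ 2 + 3 * n₂ ^ 2 + 3 * n₁ * n₂ - n₂ + a * n₁ + b * n₂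

theorem expo_add_right (a b n₁ n₂ : ℕ) :
    expo a b n₁ n₂ + n₂ = n₁ ^ 2 + 3 * n₂ ^ 2 + 3 * n₁ * n₂ + a * n₁ + b * n₂ := by
  have := le_exponent n₁ n₂
  unfold expo
  omega

theorem expo_succ_left (a b n₁ n₂ : ℕ) :
    expo a b (n₁ + 1) n₂ = (1 + a) + expo (a + 2) (b + 3) n₁ n₂ := by
  have h₁ := expo_add_right a b (n₁ + 1) n₂
  have h₂ := expo_add_right (a + 2) (b + 3) n₁ n₂
  nlinarith

theorem expo_succ_right (a b n₁ n₂ : ℕ) :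
    expo a b n₁ (n₂ + 1) = (2 + b) + expo (a + 3) (b + 6) n₁ n₂ := by
  have h₁ := expo_add_right a b n₁ (n₂ + 1)
  have h₂ := expo_add_right (a + 3) (b + 6) n₁ n₂
  nlinarith

theorem expo_shift_left (a b n₁ n₂ : ℕ) : expo (a + 1) b n₁ n₂ = expo a b n₁ n₂ + n₁ := by
  unfold expo; ring

theorem expo_shift_right (a b n₁ n₂ : ℕ) :
    expo a (b + 3) n₁ n₂ = expo a b n₁ n₂ + 3 * n₂ := by
  unfold expo; ring

theorem le_expo {a b k n₁ n₂ : ℕ} (ha : k ≤ a) (hb : k ≤ b) (h : (n₁, n₂) ≠ (0, 0)) :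
    k ≤ expo a b n₁ n₂ := by
  unfold expo
  rcases Nat.eq_zero_or_pos n₁ with rfl | h₁
  · have h₂ : 0 < n₂ := Nat.pos_of_ne_zero fun h₂ => h (by rw [h₂])
    nlinarith [Nat.zero_le (0 ^ 2 + 3 * n₂ ^ 2 + 3 * 0 * n₂ - n₂)]
  · nlinarith [Nat.zero_le (n₁ ^ 2 + 3 * n₂ ^ 2 + 3 * n₁ * n₂ - n₂), Nat.zero_le (b * n₂)]

theorem summable_summand (E : ℕ → ℕ → ℕ) : Summable (summand E) := by
  rw [MvPowerSeries.WithPiTopology.summable_iff_summable_coeff]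
  intro e
  refine summable_of_hasFiniteSupport ?_
  refine ((Finset.range (e 0 + 1) ×ˢ Finset.range (e 0 + 1)).finite_toSet).subset ?_
  intro n hn
  by_contra hlt
  refine hn ?_
  -- The power of x alone makes each coefficient a finite sum, so summability holds for every
  -- exponent function `E`.
  have hdvd : (MvPowerSeries.X 0 : Series) ^ (n.1 + 2 * n.2) ∣ summand E n :=
    Dvd.dvd.mul_right (Dvd.intro_left _ rfl) _
  refine MvPowerSeries.X_pow_dvd_iff.1 hdvd e ?_
  simp only [Finset.coe_product, Finset.coe_range, Set.mem_prod, Set.mem_Iio, not_and_or] at hlt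
  omega

/-- The double sum with exponent `expo a b`. -/
noncomputable def doubleSum (a b : ℕ) : Series := ∑' n, summand (expo a b) n

theorem hasSum_doubleSum (a b : ℕ) : HasSum (summand (expo a b)) (doubleSum a b) :=
  (summable_summand _).hasSum

theorem inv_eq_of_mul_eq (n₁ n₂ m₁ m₂ : ℕ) (u : Series)
    (h : qPoch q q m₁ * qPoch (q ^ 3) (q ^ 3) m₂ =
      qPoch q q n₁ * qPoch (q ^ 3) (q ^ 3) n₂ * u) :
    inv (qPoch q q m₁ * qPoch (q ^ 3) (q ^ 3) m₂) * u =
      inv (qPoch q q n₁ * qPoch (q ^ 3) (q ^ 3) n₂) := by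
  have h₁ := denom_mul_inv n₁ n₂
  have h₂ := denom_mul_inv m₁ m₂
  rw [h] at h₂ ⊢
  generalize inv (qPoch q q n₁ * qPoch (q ^ 3) (q ^ 3) n₂ * u) = v at *
  generalize inv (qPoch q q n₁ * qPoch (q ^ 3) (q ^ 3) n₂) = w at *
  linear_combination w * h₂ - v * u * h₁

/-- Subtracting termwise produces the factor 1 - q^n₁, which kills n₁ = 0 and otherwise cancels the
last factor of (q; q)_n₁; then n₁ is shifted by one. `doubleSum_sub_right` does the same with n₂ and
1 - q^(3n₂). -/
theorem doubleSum_sub_left (a b : ℕ) :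
    doubleSum a b - doubleSum (a + 1) b = x * q ^ (1 + a) * doubleSum (a + 2) (b + 3) := by
  have h := (hasSum_doubleSum a b).sub (hasSum_doubleSum (a + 1) b)
  have hinj : Function.Injective fun n : ℕ × ℕ => (n.1 + 1, n.2) := by
    rintro ⟨_, _⟩ ⟨_, _⟩ h
    simpa using h
  rw [← hinj.hasSum_iff] at h
  · refine h.unique (((hasSum_doubleSum (a + 2) (b + 3)).mul_left _).congr_fun ?_)
    rintro ⟨n₁, n₂⟩
    have hi := inv_eq_of_mul_eq n₁ n₂ (n₁ + 1) n₂ (1 - q ^ (n₁ + 1)) (by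
      simp only [qPoch, Finset.prod_range_succ]; ring)
    simp only [summand, Function.comp, expo_shift_left, expo_succ_left, ← hi]
    ring
  · rintro ⟨n₁, n₂⟩ hn
    obtain rfl : n₁ = 0 := by
      by_contra h0
      exact hn ⟨(n₁ - 1, n₂), by simp; omega⟩
    simp [summand, expo_shift_left]

theorem doubleSum_sub_right (a b : ℕ) :
    doubleSum a b - doubleSum a (b + 3) =
      x ^ 2 * q ^ (2 + b) * doubleSum (a + 3) (b + 6) := by
  have h := (hasSum_doubleSum a b).sub (hasSum_doubleSum a (b + 3))
  have hinj : Function.Injective fun n : ℕ × ℕ => (n.1, n.2 + 1) := by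
    rintro ⟨_, _⟩ ⟨_, _⟩ h
    simpa using h
  rw [← hinj.hasSum_iff] at h
  · refine h.unique (((hasSum_doubleSum (a + 3) (b + 6)).mul_left _).congr_fun ?_)
    rintro ⟨n₁, n₂⟩
    have hi := inv_eq_of_mul_eq n₁ n₂ n₁ (n₂ + 1) (1 - (q ^ 3) ^ (n₂ + 1)) (by
      simp only [qPoch, Finset.prod_range_succ]; ring)
    simp only [summand, Function.comp, expo_shift_right, expo_succ_right, ← hi]
    ring
  · rintro ⟨n₁, n₂⟩ hn
    obtain rfl : n₂ = 0 := by
      by_contra h0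
      exact hn ⟨(n₁, n₂ - 1), by simp; omega⟩
    simp [summand, expo_shift_right]

/-- Raising a twice and b once gives the leading term. Bringing the three remainders to the required
indices creates terms in x³, and these cancel in pairs. -/
theorem doubleSum_rec_zero (k : ℕ) :
    doubleSum (3 * k + 1) (6 * k + 3) =
      doubleSum (3 * k + 3) (6 * k + 6) + x * q ^ (3 * k + 2) * doubleSum (3 * k + 3) (6 * k + 9)
      + (x * q ^ (3 * k + 3) + x ^ 2 * q ^ (6 * k + 5)) *
        doubleSum (3 * k + 4) (6 * k + 9) := by
  have h₁ := doubleSum_sub_left (3 * k + 1) (6 * k + 3)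
  have h₂ := doubleSum_sub_left (3 * k + 2) (6 * k + 3)
  have h₃ := doubleSum_sub_right (3 * k + 3) (6 * k + 3)
  have h₄ := doubleSum_sub_right (3 * k + 3) (6 * k + 6)
  have h₅ := doubleSum_sub_right (3 * k + 4) (6 * k + 6)
  have h₆ := doubleSum_sub_left (3 * k + 4) (6 * k + 9)
  have h₇ := doubleSum_sub_left (3 * k + 5) (6 * k + 9)
  simp only [add_assoc, Nat.reduceAdd] at *
  linear_combination h₁ + h₂ + h₃ + x * q ^ (3 * k + 2) * h₄ + x * q ^ (3 * k + 3) * h₅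
    - x ^ 2 * q ^ (6 * k + 5) * (h₆ + h₇)

theorem doubleSum_rec_one (k : ℕ) :
    doubleSum (3 * k) (6 * k + 3) =
      (1 + x * q ^ (3 * k + 1)) * doubleSum (3 * k + 3) (6 * k + 6)
      + x * q ^ (3 * k + 2) * doubleSum (3 * k + 3) (6 * k + 9)
      + (x * q ^ (3 * k + 3) + x ^ 2 * q ^ (6 * k + 4) + x ^ 2 * q ^ (6 * k + 5)) *
        doubleSum (3 * k + 4) (6 * k + 9) := by
  have h₀ := doubleSum_rec_zero k
  have h₁ := doubleSum_sub_left (3 * k) (6 * k + 3)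
  have h₂ := doubleSum_sub_left (3 * k + 2) (6 * k + 6)
  simp only [add_assoc, Nat.reduceAdd] at *
  linear_combination h₀ + h₁ + x * q ^ (3 * k + 1) * h₂

theorem doubleSum_rec_two (k : ℕ) :
    doubleSum (3 * k) (6 * k) =
      (1 + x * q ^ (3 * k + 1) + x ^ 2 * q ^ (6 * k + 2)) * doubleSum (3 * k + 3) (6 * k + 6)
      + x * q ^ (3 * k + 2) * doubleSum (3 * k + 3) (6 * k + 9)
      + (x * q ^ (3 * k + 3) + x ^ 2 * q ^ (6 * k + 4) + x ^ 2 * q ^ (6 * k + 5)) *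
        doubleSum (3 * k + 4) (6 * k + 9) := by
  have h₀ := doubleSum_rec_one k
  have h₁ := doubleSum_sub_right (3 * k) (6 * k)
  linear_combination h₀ + h₁

theorem q_pow_dvd_doubleSum_sub_one {a b k : ℕ} (ha : k ≤ a) (hb : k ≤ b) :
    q ^ k ∣ doubleSum a b - 1 := by
  have h0 : summand (expo a b) (0, 0) = 1 := by
    have := denom_mul_inv 0 0
    simp only [summand, expo, qPoch] at *
    simpa using this
  refine MvPowerSeries.X_pow_dvd_iff.2 fun e he => ?_
  rw [map_sub, sub_eq_zero]
  refine ((MvPowerSeries.WithPiTopology.hasSum_iff_hasSum_coeff.1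
    (hasSum_doubleSum a b)) e).unique ?_
  rw [← h0]
  refine hasSum_single (0, 0) fun n hn => ?_
  have hdvd : (MvPowerSeries.X 1 : Series) ^ expo a b n.1 n.2 ∣ summand (expo a b) n :=
    Dvd.dvd.mul_right (Dvd.intro _ rfl) _
  exact MvPowerSeries.X_pow_dvd_iff.1 hdvd e (he.trans_le (le_expo ha hb hn))


/-! ### Type II partitions in terms of multiplicities -/

/-- The type II condition on a multiset of parts, expressed through multiplicities. -/
def LocalII (s : Multiset ℕ) : Prop :=
  (∀ a, s.count a + s.count (a + 1) + s.count (a + 2) ≤ 2) ∧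
  (∀ a, 2 ≤ s.count a → a % 3 = 1) ∧
  (∀ a, 1 ≤ s.count a → 1 ≤ s.count (a + 1) → a % 3 = 2)

theorem LocalII.mono {s t : Multiset ℕ} (h : ∀ a, s.count a ≤ t.count a) (ht : LocalII t) :
    LocalII s := by
  obtain ⟨h₁, h₂, h₃⟩ := ht
  refine ⟨fun a => ?_, fun a ha => h₂ a (ha.trans (h a)),
    fun a ha hb => h₃ a (ha.trans (h a)) (hb.trans (h _))⟩
  have := h₁ a
  have := h a
  have := h (a + 1)
  have := h (a + 2)
  omega

/-- The type II condition on a list of parts. -/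
def ListII (l : List ℕ) : Prop :=
  (∀ (i : ℕ) (h : i + 2 < l.length), l[i + 2] + 3 ≤ l[i]) ∧
  (∀ (i : ℕ) (h : i + 1 < l.length), l[i] ≤ l[i + 1] + 1 → l[i] + l[i + 1] ≡ 2 [MOD 3])

theorem listII_cons_cons_cons (c b a : ℕ) (t : List ℕ) :
    ListII (c :: b :: a :: t) ↔
      a + 3 ≤ c ∧ (c ≤ b + 1 → c + b ≡ 2 [MOD 3]) ∧ ListII (b :: a :: t) := by
  constructor
  · rintro ⟨h₁, h₂⟩
    refine ⟨h₁ 0 (by simp), h₂ 0 (by simp), fun i h => h₁ (i + 1) ?_, fun i h => h₂ (i + 1) ?_⟩ <;>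
    · simp only [List.length_cons] at h ⊢
      omega
  · rintro ⟨h₁, h₂, h₃, h₄⟩
    refine ⟨fun i h => ?_, fun i h => ?_⟩
    · cases i with
      | zero => exact h₁
      | succ i => exact h₃ i (by simpa using h)
    · cases i with
      | zero => exact h₂
      | succ i => exact h₄ i (by simpa using h)

/-- Difference at least 3 at distance two means that three consecutive integers carry at most two
parts. Modulo 3, 2a ≡ 2 forces a ≡ 1 for a repeated part, and 2a + 1 ≡ 2 forces a ≡ 2 for adjacent
parts. The induction removes the largest part. -/
theorem listII_iff_localII : ∀ l : List ℕ, l.Pairwise (· ≥ ·) → (ListII l ↔ LocalII (l : Multiset ℕ))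
  | [], _ => by simp [ListII, LocalII]
  | [c], _ => by
    simp only [ListII, LocalII, Multiset.coe_count, List.count_cons, List.count_nil, beq_iff_eq]
    refine iff_of_true ⟨by simp, by simp⟩ ⟨fun a => ?_, fun a => ?_, fun a => ?_⟩ <;> split_ifs <;>
      omega
  | [c, b], hl => by
    simp only [List.pairwise_cons, List.mem_singleton, forall_eq] at hl
    have hII : ListII [c, b] ↔ (c ≤ b + 1 → c + b ≡ 2 [MOD 3]) := by
      refine ⟨fun h => h.2 0 (by simp), fun h => ⟨by simp, fun i hi => ?_⟩⟩
      obtain rfl : i = 0 := by simpa using hi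
      exact h
    rw [hII]
    simp only [LocalII, Multiset.coe_count, List.count_cons, List.count_nil, beq_iff_eq,
      Nat.ModEq]
    constructor
    · intro h
      refine ⟨fun a => ?_, fun a => ?_, fun a => ?_⟩ <;> split_ifs <;> omega
    · rintro ⟨-, h₂, h₃⟩ h
      have h₂ := h₂ b
      have h₃ := h₃ b
      split_ifs at h₂ h₃ <;> omega
  | c :: b :: a :: t, hl => by
    have hl' := hl.of_cons
    rw [listII_cons_cons_cons, listII_iff_localII (b :: a :: t) hl']
    simp only [List.pairwise_cons, List.mem_cons, forall_eq_or_imp] at hl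
    obtain ⟨⟨hcb, hca, -⟩, ⟨hba, -⟩, hat, -⟩ := hl
    -- Above a the tail contains only b. Once c ≥ a + 3, every local condition involving c lies
    -- above a, so it concerns b and c alone.
    have hu : ∀ w, a < w → (b :: a :: t).count w = if b = w then 1 else 0 := fun w hw => by
      have h₀ : t.count w = 0 := List.count_eq_zero.2 fun hm => absurd (hat w hm) (by simpa using hw)
      simp only [List.count_cons, beq_iff_eq, h₀, if_neg hw.ne]
      omega
    have hb : 1 ≤ (b :: a :: t).count b := List.count_pos_iff.2 (by simp)
    have hab : 1 ≤ (b :: a :: t).count a := List.count_pos_iff.2 (by simp)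
    have hab' : b = a → 2 ≤ (b :: a :: t).count a := by
      rintro rfl
      simp
    generalize b :: a :: t = s at hu hb hab hab' ⊢
    simp only [LocalII, Multiset.coe_count, List.count_cons, beq_iff_eq, Nat.ModEq]
    constructor
    · rintro ⟨h₁, h₂, h₃, h₄, h₅⟩
      refine ⟨fun w => ?_, fun w => ?_, fun w => ?_⟩
      · have := h₃ w
        by_cases hw : c ≤ w + 2
        · have e₀ := hu w (by omega)
          have e₁ := hu (w + 1) (by omega)
          have e₂ := hu (w + 2) (by omega)
          rw [e₀, e₁, e₂]
          split_ifs <;> omega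
        · rw [if_neg (by omega), if_neg (by omega), if_neg (by omega)]
          exact this
      · by_cases hw : c = w
        · have e₀ := hu w (by omega)
          rw [e₀]
          split_ifs <;> omega
        · rw [if_neg hw]
          exact h₄ w
      · by_cases hw : c ≤ w + 1
        · have e₀ := hu w (by omega)
          have e₁ := hu (w + 1) (by omega)
          rw [e₀, e₁]
          split_ifs <;> omega
        · rw [if_neg (by omega), if_neg (by omega)]
          exact h₅ w
    · rintro ⟨h₁, h₂, h₃⟩
      refine ⟨?_, fun hcb' => ?_, fun w => ?_, fun w hw => ?_, fun w hw hw' => ?_⟩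
      · have h₁ := h₁ a
        -- If c < a + 3, the window {a, a+1, a+2} contains a, b and c.
        by_contra hlt
        have hb' : b = a ∨ b = a + 1 ∨ b = a + 2 := by omega
        rcases hb' with rfl | rfl | rfl <;> split_ifs at h₁ <;> omega
      · have h₂ := h₂ b
        have h₃ := h₃ b
        split_ifs at h₂ h₃ <;> omega
      · have := h₁ w
        omega
      · exact h₂ w (by omega)
      · exact h₃ w (by omega) (by omega)

theorem isTypeII_iff_localII (p : Ptn) : IsTypeII p ↔ LocalII p.2.parts := by
  have h := listII_iff_localII (partsList p) (Multiset.pairwise_sort _ _)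
  rw [partsList, Multiset.sort_eq] at h
  exact h

/-! ### Decomposition according to the smallest block of three integers -/

theorem ptn_ext {p p' : Ptn} (h : p.2.parts = p'.2.parts) : p = p' := by
  obtain ⟨n, r⟩ := p
  obtain ⟨n', r'⟩ := p'
  obtain rfl : n = n' := by rw [← r.parts_sum, ← r'.parts_sum]; exact congrArg _ h
  exact congrArg _ (Nat.Partition.ext h)

/-- The partition with a given multiset of positive parts. -/
def ofParts (s : Multiset ℕ) (hs : ∀ {i}, i ∈ s → 0 < i) : Ptn := ⟨s.sum, s, hs, rfl⟩

/-- The partition whose parts are those of `A` together with those of `p`. -/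
def union (A p : Ptn) : Ptn :=
  ofParts (A.2.parts + p.2.parts) fun hi =>
    (Multiset.mem_add.1 hi).elim (fun h => A.2.parts_pos h) fun h => p.2.parts_pos h

theorem union_injective (A : Ptn) : Function.Injective (union A) := fun _ _ h =>
  ptn_ext (add_left_cancel (congrArg (fun r : Ptn => r.2.parts) h))

theorem genFun_image_union (A : Ptn) (S : Set Ptn) :
    genFun (union A '' S) = x ^ numParts A * q ^ A.1 * genFun S := by
  have h := hasSum_genFun (union A '' S)
  rw [← (Equiv.Set.image _ S (union_injective A)).hasSum_iff] at h
  refine h.unique (((hasSum_genFun S).mul_left _).congr_fun fun p => ?_)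
  have h₁ : numParts (union A p) = numParts A + numParts p := Multiset.card_add _ _
  have h₂ : (union A p).1 = A.1 + p.1.1 := by
    simp [union, ofParts, A.2.parts_sum, p.1.2.parts_sum]
  simp only [Function.comp, Equiv.Set.image_apply, h₁, h₂]
  ring

theorem genFun_biUnion {ι : Type*} (s : Finset ι) (t : ι → Set Ptn)
    (hs : (s : Set ι).Pairwise (Function.onFun Disjoint t)) :
    genFun (⋃ i ∈ s, t i) = ∑ i ∈ s, genFun (t i) :=
  (hasSum_genFun _).unique
    (hasSum_sum_disjoint (f := fun p : Ptn => x ^ numParts p * q ^ p.1) s hs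
      fun i _ => hasSum_genFun (t i))

/-- Type II partitions with all parts greater than `3k` in which `3k + 1` appears at most `c`
times. -/
def levelSet (k c : ℕ) : Set Ptn :=
  {p | LocalII p.2.parts ∧ (∀ a ≤ 3 * k, p.2.parts.count a = 0) ∧
    p.2.parts.count (3 * k + 1) ≤ c}

/-- The possible multisets of parts of a type II partition in `{3k + 1, 3k + 2, 3k + 3}`. -/
def block (k : ℕ) : Fin 7 → Multiset ℕ :=
  ![0, {3 * k + 1}, {3 * k + 1, 3 * k + 1}, {3 * k + 2}, {3 * k + 3}, {3 * k + 1, 3 * k + 3},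
    {3 * k + 2, 3 * k + 3}]

/-- The multiplicity of `3k + 1` in each block. -/
def low : Fin 7 → ℕ := ![0, 1, 2, 0, 0, 1, 0]

/-- The maximal multiplicity of `3k + 4` above each block. -/
def cap : Fin 7 → ℕ := ![2, 2, 2, 1, 0, 0, 0]

theorem pos_of_mem_block (k : ℕ) (i : Fin 7) {a : ℕ} (h : a ∈ block k i) : 0 < a := by
  fin_cases i <;> simp [block] at h <;> omega

/-- A block as a partition. -/
def blockPtn (k : ℕ) (i : Fin 7) : Ptn := ofParts (block k i) (pos_of_mem_block k i)

theorem count_union_blockPtn (k : ℕ) (i : Fin 7) (p : Ptn) (a : ℕ) :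
    (union (blockPtn k i) p).2.parts.count a = (block k i).count a + p.2.parts.count a :=
  Multiset.count_add _ _ _

theorem mem_union_image_iff (A p : Ptn) (S : Set Ptn) :
    p ∈ union A '' S ↔ ∃ p' ∈ S, ∀ a, p.2.parts.count a = A.2.parts.count a + p'.2.parts.count a := by
  constructor
  · rintro ⟨p', hp', rfl⟩
    exact ⟨p', hp', fun a => Multiset.count_add _ _ _⟩
  · rintro ⟨p', hp', h⟩
    refine ⟨p', hp', ptn_ext (Multiset.ext.2 fun a => ?_)⟩
    rw [h]
    exact Multiset.count_add _ _ _

theorem exists_ptn_count {A : Multiset ℕ} {p : Ptn} (h : ∀ a, A.count a ≤ p.2.parts.count a) :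
    ∃ p' : Ptn, ∀ a, p.2.parts.count a = A.count a + p'.2.parts.count a :=
  ⟨ofParts (p.2.parts - A) fun hi => p.2.parts_pos (Multiset.mem_of_le tsub_le_self hi), fun a => by
    have h' : (p.2.parts - A).count a = _ := Multiset.count_sub a _ _
    have := h a
    change _ = _ + (p.2.parts - A).count a
    omega⟩

theorem count_block (k : ℕ) (i : Fin 7) (a : ℕ) :
    (block k i).count a = if a = 3 * k + 1 then low i else
      if a = 3 * k + 2 then ![0, 0, 0, 1, 0, 0, 1] i else
      if a = 3 * k + 3 then ![0, 0, 0, 0, 1, 1, 1] i else 0 := by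
  fin_cases i <;>
  · simp only [block, low, Multiset.insert_eq_cons, Multiset.count_cons, Multiset.count_singleton,
      Fin.zero_eta, Fin.mk_one, Fin.reduceFinMk, Matrix.cons_val, Multiset.count_zero]
    split_ifs <;> omega

/-- Only 3k+4 needs control: a part 3k+2 shares a window with it, and 3k+3 cannot be adjacent to it
because 3k+3 is not 2 modulo 3. The window {3k+3, 3k+4, 3k+5} is then harmless, since 3k+5 is not 1
modulo 3 and so cannot repeat. -/
theorem union_mem_levelSet {k c : ℕ} {i : Fin 7} (hi : low i ≤ c) {p : Ptn}
    (hp : p ∈ levelSet (k + 1) (cap i)) : union (blockPtn k i) p ∈ levelSet k c := by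
  obtain ⟨⟨h₁, h₂, h₃⟩, h₄, h₅⟩ := hp
  have hf : ∀ a, (union (blockPtn k i) p).2.parts.count a =
      (block k i).count a + p.2.parts.count a := count_union_blockPtn k i p
  rw [levelSet, Set.mem_ofPred_eq]
  generalize (union (blockPtn k i) p).2.parts = s at hf ⊢
  have f₀ : ∀ a ≤ 3 * k, s.count a = 0 := fun a ha => by
    rw [hf, count_block, h₄ a (by omega)]
    split_ifs <;> omega
  have fg : ∀ a, 3 * k + 4 ≤ a → s.count a = p.2.parts.count a := fun a ha => by
    rw [hf, count_block]
    split_ifs <;> omega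
  have f₁ := hf (3 * k + 1)
  have f₂ := hf (3 * k + 2)
  have f₃ := hf (3 * k + 3)
  have f₄ := fg (3 * k + 4) le_rfl
  have f₅ := fg (3 * k + 5) (by omega)
  have g₅ := h₂ (3 * k + 5)
  have w₄ := h₁ (3 * k + 4)
  simp only [count_block, if_true, Nat.add_left_cancel_iff, OfNat.ofNat_ne_one, Nat.reduceEqDiff,
    if_false, h₄ (3 * k + 1) (by omega), h₄ (3 * k + 2) (by omega), h₄ (3 * k + 3) (by omega)]
    at f₁ f₂ f₃
  have key : low i ≤ c ∧ p.2.parts.count (3 * k + 4) ≤ cap i := ⟨hi, h₅⟩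
  have hcases : s.count (3 * k + 1) ≤ c ∧ (s.count (3 * k + 2) = 0 ∧ s.count (3 * k + 3) = 0 ∧
        s.count (3 * k + 1) ≤ 2 ∧ s.count (3 * k + 4) ≤ 2 ∨
      s.count (3 * k + 1) = 0 ∧ s.count (3 * k + 2) = 1 ∧ s.count (3 * k + 3) = 0 ∧
        s.count (3 * k + 4) ≤ 1 ∨
      s.count (3 * k + 1) + s.count (3 * k + 2) ≤ 1 ∧ s.count (3 * k + 3) = 1 ∧
        s.count (3 * k + 4) = 0) := by
    rw [f₁, f₂, f₃, f₄]
    revert key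
    clear * -
    generalize p.2.parts.count (3 * k + 4) = g₄
    fin_cases i <;> simp [low, cap]
  refine ⟨⟨fun a => ?_, fun a ha => ?_, fun a ha hb => ?_⟩, f₀, hcases.1⟩
  · by_cases ha : 3 * k + 4 ≤ a
    · rw [fg a ha, fg (a + 1) (by omega), fg (a + 2) (by omega)]
      exact h₁ a
    by_cases ha' : a + 2 ≤ 3 * k
    · rw [f₀ a (by omega), f₀ (a + 1) (by omega), f₀ _ ha']
      omega
    have : a + 1 = 3 * k ∧ a + 2 = 3 * k + 1 ∨ a = 3 * k ∨ a = 3 * k + 1 ∨ a = 3 * k + 2 ∨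
      a = 3 * k + 3 := by omega
    rcases this with ⟨e₁, e₂⟩ | rfl | rfl | rfl | rfl
    · rw [e₁, e₂, f₀ a (by omega), f₀ _ le_rfl]
      omega
    · rw [f₀ _ le_rfl]
      omega
    all_goals
      simp only [add_assoc, Nat.reduceAdd] at w₄ ⊢
      omega
  · by_cases ha' : 3 * k + 4 ≤ a
    · exact h₂ a (fg a ha' ▸ ha)
    have : a ≤ 3 * k ∨ a = 3 * k + 1 ∨ a = 3 * k + 2 ∨ a = 3 * k + 3 := by omega
    rcases this with h | rfl | rfl | rfl
    · have := f₀ a h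
      omega
    all_goals omega
  · by_cases ha' : 3 * k + 4 ≤ a
    · exact h₃ a (fg a ha' ▸ ha) (fg (a + 1) (by omega) ▸ hb)
    have : a ≤ 3 * k ∨ a = 3 * k + 1 ∨ a = 3 * k + 2 ∨ a = 3 * k + 3 := by omega
    rcases this with h | rfl | rfl | rfl
    · have := f₀ a h
      omega
    all_goals
      simp only [add_assoc, Nat.reduceAdd] at hb
      omega

theorem exists_block {k c : ℕ} {p : Ptn} (hp : p ∈ levelSet k c) :
    ∃ i, low i ≤ c ∧ p ∈ union (blockPtn k i) '' levelSet (k + 1) (cap i) := by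
  obtain ⟨hII, h₀, hc⟩ := hp
  have h := hII
  obtain ⟨h₁, h₂, h₃⟩ := h
  have w₁ := h₁ (3 * k + 1)
  have w₂ := h₁ (3 * k + 2)
  have w₄ := h₁ (3 * k + 4)
  have d₂ := h₂ (3 * k + 2)
  have d₃ := h₂ (3 * k + 3)
  have s₁ := h₃ (3 * k + 1)
  have s₃ := h₃ (3 * k + 3)
  simp only [add_assoc, Nat.reduceAdd] at w₁ w₂ w₄ s₁ s₃
  have key : ∃ i : Fin 7, low i = p.2.parts.count (3 * k + 1) ∧
      ![0, 0, 0, 1, 0, 0, 1] i = p.2.parts.count (3 * k + 2) ∧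
      ![0, 0, 0, 0, 1, 1, 1] i = p.2.parts.count (3 * k + 3) ∧
      p.2.parts.count (3 * k + 4) ≤ cap i := by
    generalize p.2.parts.count (3 * k + 1) = f₁ at *
    generalize p.2.parts.count (3 * k + 2) = f₂ at *
    generalize p.2.parts.count (3 * k + 3) = f₃ at *
    generalize p.2.parts.count (3 * k + 4) = f₄ at *
    -- The congruences forbid repeating 3k+2 or 3k+3 and forbid the adjacent pairs (3k+1, 3k+2) and
    -- (3k+3, 3k+4); with the window bounds only seven cases survive.
    have hf : (f₁ = 0 ∧ f₂ = 0 ∧ f₃ = 0 ∧ f₄ ≤ 2) ∨ (f₁ = 1 ∧ f₂ = 0 ∧ f₃ = 0 ∧ f₄ ≤ 2) ∨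
        (f₁ = 2 ∧ f₂ = 0 ∧ f₃ = 0 ∧ f₄ ≤ 2) ∨ (f₁ = 0 ∧ f₂ = 1 ∧ f₃ = 0 ∧ f₄ ≤ 1) ∨
        (f₁ = 0 ∧ f₂ = 0 ∧ f₃ = 1 ∧ f₄ ≤ 0) ∨ (f₁ = 1 ∧ f₂ = 0 ∧ f₃ = 1 ∧ f₄ ≤ 0) ∨
        (f₁ = 0 ∧ f₂ = 1 ∧ f₃ = 1 ∧ f₄ ≤ 0) := by omega
    rcases hf with h | h | h | h | h | h | h <;> obtain ⟨rfl, rfl, rfl, h⟩ := h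
    exacts [⟨0, rfl, rfl, rfl, h⟩, ⟨1, rfl, rfl, rfl, h⟩, ⟨2, rfl, rfl, rfl, h⟩,
      ⟨3, rfl, rfl, rfl, h⟩, ⟨4, rfl, rfl, rfl, h⟩, ⟨5, rfl, rfl, rfl, h⟩, ⟨6, rfl, rfl, rfl, h⟩]
  obtain ⟨i, hi₁, hi₂, hi₃, hi₄⟩ := key
  have hcount : ∀ a, (block k i).count a = if a ≤ 3 * k + 3 then p.2.parts.count a else 0 := by
    intro a
    rw [count_block, hi₁, hi₂, hi₃]
    split_ifs
    all_goals first
      | rfl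
      | (subst a; rfl)
      | (exfalso; omega)
      | exact (h₀ a (by omega)).symm
  obtain ⟨p', hp'⟩ := exists_ptn_count (A := block k i) (p := p) fun a => by
    rw [hcount]
    split_ifs <;> omega
  refine ⟨i, hi₁ ▸ hc, (mem_union_image_iff _ _ _).2 ⟨p', ⟨?_, fun a ha => ?_, ?_⟩, hp'⟩⟩
  · exact hII.mono fun a => (hp' a).symm ▸ Nat.le_add_left _ _
  · have := hp' a
    rw [hcount, if_pos (by omega)] at this
    omega
  · have := hp' (3 * k + 4)
    rw [hcount, if_neg (by omega), zero_add] at this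
    exact this ▸ hi₄

theorem levelSet_eq (k c : ℕ) :
    levelSet k c = ⋃ i ∈ Finset.univ.filter (fun i => low i ≤ c),
      union (blockPtn k i) '' levelSet (k + 1) (cap i) := by
  ext p
  simp only [Set.mem_iUnion, Finset.mem_filter, Finset.mem_univ, true_and, exists_prop]
  refine ⟨exists_block, ?_⟩
  rintro ⟨i, hi, p', hp', rfl⟩
  exact union_mem_levelSet hi hp'

theorem block_injective {k : ℕ} {i j : Fin 7}
    (h : ∀ a, 3 * k < a → a ≤ 3 * k + 3 → (block k i).count a = (block k j).count a) : i = j := by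
  have h₁ := h (3 * k + 1) (by omega) (by omega)
  have h₂ := h (3 * k + 2) (by omega) (by omega)
  have h₃ := h (3 * k + 3) (by omega) (by omega)
  simp only [count_block] at h₁ h₂ h₃
  simp only [if_true, Nat.add_left_cancel_iff, OfNat.ofNat_ne_one, Nat.reduceEqDiff, if_false]
    at h₁ h₂ h₃
  clear h
  revert i j
  decide

theorem genFun_levelSet (k c : ℕ) :
    genFun (levelSet k c) = ∑ i with low i ≤ c,
      x ^ (block k i).card * q ^ (block k i).sum * genFun (levelSet (k + 1) (cap i)) := by
  rw [levelSet_eq, genFun_biUnion]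
  · exact Finset.sum_congr rfl fun i _ => genFun_image_union _ _
  · intro i _ j _ hij
    rw [Function.onFun, Set.disjoint_left]
    rintro _ ⟨p, hp, rfl⟩ ⟨p', hp', h⟩
    refine hij (block_injective (k := k) fun a ha ha' => ?_)
    have h' := congrArg (fun r : Ptn => r.2.parts.count a) h
    simp only [count_union_blockPtn, hp.2.1 a (by omega), hp'.2.1 a (by omega)] at h'
    exact h'.symm

/-- A nonempty member has a part above 3k, so only the empty partition has weight below 3k. -/
theorem q_pow_dvd_genFun_levelSet_sub_one (k c : ℕ) : q ^ (3 * k) ∣ genFun (levelSet k c) - 1 := by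
  refine MvPowerSeries.X_pow_dvd_iff.2 fun e he => ?_
  have hp : ∀ p ∈ levelSet k c, p.1 = e 1 → p.2.parts = 0 := by
    intro p hp hpe
    refine Multiset.eq_zero_of_forall_notMem fun a ha => ?_
    have h₁ : a ≤ p.1 := p.2.parts_sum ▸ Multiset.le_sum_of_mem ha
    exact absurd (hp.2.1 a (by omega)) (Multiset.count_pos.2 ha).ne'
  let p₀ : Ptn := ofParts 0 (by simp)
  have hp₀ : p₀ ∈ levelSet k c := by
    simp [levelSet, LocalII, p₀, ofParts]
  rw [map_sub, sub_eq_zero, MvPowerSeries.coeff_one]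
  change (Set.ncard _ : ℤ) = _
  split_ifs with h0
  · subst h0
    rw [show {p : Ptn | p ∈ levelSet k c ∧ numParts p = (0 : Fin 2 →₀ ℕ) 0 ∧
      p.1 = (0 : Fin 2 →₀ ℕ) 1} = {p₀} from ?_]
    · simp
    · ext p
      refine ⟨fun h => ptn_ext (hp p h.1 h.2.2), ?_⟩
      rintro rfl
      exact ⟨hp₀, rfl, rfl⟩
  · rw [show {p : Ptn | p ∈ levelSet k c ∧ numParts p = e 0 ∧ p.1 = e 1} = ∅ from ?_]
    · simp
    · refine Set.eq_empty_of_forall_notMem fun p h => h0 ?_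
      have h₁ : p = p₀ := ptn_ext (hp p h.1 h.2.2)
      obtain ⟨-, h₂, h₃⟩ := h
      rw [h₁] at h₂ h₃
      ext i
      fin_cases i
      · exact h₂.symm
      · exact h₃.symm

theorem genFun_levelSet_zero (k : ℕ) :
    genFun (levelSet k 0) = genFun (levelSet (k + 1) 2)
      + x * q ^ (3 * k + 2) * genFun (levelSet (k + 1) 1)
      + (x * q ^ (3 * k + 3) + x ^ 2 * q ^ (6 * k + 5)) * genFun (levelSet (k + 1) 0) := by
  rw [genFun_levelSet, Finset.sum_filter]
  simp [Fin.sum_univ_seven, low, cap, block]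
  ring

theorem genFun_levelSet_one (k : ℕ) :
    genFun (levelSet k 1) = (1 + x * q ^ (3 * k + 1)) * genFun (levelSet (k + 1) 2)
      + x * q ^ (3 * k + 2) * genFun (levelSet (k + 1) 1)
      + (x * q ^ (3 * k + 3) + x ^ 2 * q ^ (6 * k + 4) + x ^ 2 * q ^ (6 * k + 5)) *
        genFun (levelSet (k + 1) 0) := by
  rw [genFun_levelSet, Finset.sum_filter]
  simp [Fin.sum_univ_seven, low, cap, block]
  ring

theorem genFun_levelSet_two (k : ℕ) :
    genFun (levelSet k 2) =
      (1 + x * q ^ (3 * k + 1) + x ^ 2 * q ^ (6 * k + 2)) * genFun (levelSet (k + 1) 2)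
      + x * q ^ (3 * k + 2) * genFun (levelSet (k + 1) 1)
      + (x * q ^ (3 * k + 3) + x ^ 2 * q ^ (6 * k + 4) + x ^ 2 * q ^ (6 * k + 5)) *
        genFun (levelSet (k + 1) 0) := by
  rw [genFun_levelSet, Finset.sum_filter]
  simp [Fin.sum_univ_seven, low, cap, block]
  ring

/-! ### Comparison of the two sides -/

/-- Induction on the number d of descents still available: the base case has N ≤ 3k, where both
sides are 1 modulo q^N. A step to k+1 gains 3, of which only 1 is used. -/
theorem q_pow_dvd_genFun_sub_doubleSum (N d : ℕ) : ∀ k, N ≤ 3 * k + d →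
    q ^ N ∣ genFun (levelSet k 2) - doubleSum (3 * k) (6 * k) ∧
    q ^ N ∣ genFun (levelSet k 1) - doubleSum (3 * k) (6 * k + 3) ∧
    q ^ N ∣ genFun (levelSet k 0) - doubleSum (3 * k + 1) (6 * k + 3) := by
  induction d with
  | zero =>
    intro k hk
    have h : ∀ c a b, 3 * k ≤ a → 3 * k ≤ b → q ^ N ∣ genFun (levelSet k c) - doubleSum a b := by
      intro c a b ha hb
      refine (pow_dvd_pow q hk).trans ?_
      have := dvd_sub (q_pow_dvd_genFun_levelSet_sub_one k c) (q_pow_dvd_doubleSum_sub_one ha hb)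
      simpa using this
    exact ⟨h _ _ _ (by omega) (by omega), h _ _ _ (by omega) (by omega),
      h _ _ _ (by omega) (by omega)⟩
  | succ d ih =>
    intro k hk
    obtain ⟨⟨u, hu⟩, ⟨v, hv⟩, ⟨w, hw⟩⟩ := ih (k + 1) (by omega)
    simp only [mul_add, mul_one, add_assoc, Nat.reduceAdd] at hu hv hw
    rw [genFun_levelSet_zero, genFun_levelSet_one, genFun_levelSet_two, doubleSum_rec_zero,
      doubleSum_rec_one, doubleSum_rec_two]
    refine ⟨⟨(1 + x * q ^ (3 * k + 1) + x ^ 2 * q ^ (6 * k + 2)) * u + x * q ^ (3 * k + 2) * v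
      + (x * q ^ (3 * k + 3) + x ^ 2 * q ^ (6 * k + 4) + x ^ 2 * q ^ (6 * k + 5)) * w, ?_⟩,
      ⟨(1 + x * q ^ (3 * k + 1)) * u + x * q ^ (3 * k + 2) * v
      + (x * q ^ (3 * k + 3) + x ^ 2 * q ^ (6 * k + 4) + x ^ 2 * q ^ (6 * k + 5)) * w, ?_⟩,
      ⟨u + x * q ^ (3 * k + 2) * v + (x * q ^ (3 * k + 3) + x ^ 2 * q ^ (6 * k + 5)) * w, ?_⟩⟩
    · linear_combination (1 + x * q ^ (3 * k + 1) + x ^ 2 * q ^ (6 * k + 2)) * hu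
        + x * q ^ (3 * k + 2) * hv
        + (x * q ^ (3 * k + 3) + x ^ 2 * q ^ (6 * k + 4) + x ^ 2 * q ^ (6 * k + 5)) * hw
    · linear_combination (1 + x * q ^ (3 * k + 1)) * hu + x * q ^ (3 * k + 2) * hv
        + (x * q ^ (3 * k + 3) + x ^ 2 * q ^ (6 * k + 4) + x ^ 2 * q ^ (6 * k + 5)) * hw
    · linear_combination hu + x * q ^ (3 * k + 2) * hv
        + (x * q ^ (3 * k + 3) + x ^ 2 * q ^ (6 * k + 5)) * hw

theorem eq_of_forall_q_pow_dvd {f g : Series} (h : ∀ N, q ^ N ∣ f - g) : f = g := by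
  rw [← sub_eq_zero]
  ext e
  simpa using MvPowerSeries.X_pow_dvd_iff.1 (h (e 1 + 1)) e (Nat.lt_succ_self _)

theorem count_zero_parts (p : Ptn) : p.2.parts.count 0 = 0 :=
  Multiset.count_eq_zero.2 fun h => (p.2.parts_pos h).ne rfl

/-! ### The three sets as level sets with k = 0 -/

theorem typeIISmallestGe_one : typeIISmallestGe 1 = levelSet 0 2 := by
  ext p
  rw [typeIISmallestGe, levelSet, Set.mem_ofPred_eq, Set.mem_ofPred_eq, isTypeII_iff_localII]
  refine and_congr_right fun h => iff_of_true (fun a ha => p.2.parts_pos ha) ⟨fun a ha => ?_, ?_⟩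
  · obtain rfl : a = 0 := by simpa using ha
    exact count_zero_parts p
  -- The window {1, 2, 3} already limits 1 to two occurrences, so c = 2 imposes nothing.
  · have := h.1 1
    simp only [mul_zero, zero_add]
    omega

theorem typeIISmallestGe_two : typeIISmallestGe 2 = levelSet 0 0 := by
  ext p
  rw [typeIISmallestGe, levelSet, Set.mem_ofPred_eq, Set.mem_ofPred_eq, isTypeII_iff_localII]
  refine and_congr_right fun _ => ⟨fun h => ⟨fun a ha => ?_, ?_⟩, fun h a ha => ?_⟩
  · obtain rfl : a = 0 := by simpa using ha
    exact count_zero_parts p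
  · exact (Multiset.count_eq_zero.2 fun h' => absurd (h 1 h') (by simp)).le
  · have h₀ := p.2.parts_pos ha
    have h₁ : a ≠ 1 := by
      rintro rfl
      exact absurd (Nat.le_zero.1 h.2) (Multiset.count_pos.2 ha).ne'
    omega

theorem typeIIOneAtMostOnce_eq : typeIIOneAtMostOnce = levelSet 0 1 := by
  ext p
  rw [typeIIOneAtMostOnce, levelSet, Set.mem_ofPred_eq, Set.mem_ofPred_eq, isTypeII_iff_localII]
  refine and_congr_right fun _ => ⟨fun h => ⟨fun a ha => ?_, h⟩, fun h => h.2⟩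
  obtain rfl : a = 0 := by simpa using ha
  exact count_zero_parts p

end TypeIIPartitions

theorem mainTheorem2 :
    HasSum
      (TypeIIPartitions.summand fun n₁ n₂ => n₁ ^ 2 + 3 * n₂ ^ 2 + 3 * n₁ * n₂ - n₂)
      (TypeIIPartitions.genFun (TypeIIPartitions.typeIISmallestGe 1)) ∧
    HasSum
      (TypeIIPartitions.summand fun n₁ n₂ => n₁ ^ 2 + 3 * n₂ ^ 2 + 3 * n₁ * n₂ + n₁ + 2 * n₂)
      (TypeIIPartitions.genFun (TypeIIPartitions.typeIISmallestGe 2)) ∧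
    HasSum
      (TypeIIPartitions.summand fun n₁ n₂ => n₁ ^ 2 + 3 * n₂ ^ 2 + 3 * n₁ * n₂ + 2 * n₂)
      (TypeIIPartitions.genFun TypeIIPartitions.typeIIOneAtMostOnce) := by
  open TypeIIPartitions in
  have h := fun N => q_pow_dvd_genFun_sub_doubleSum N N 0 (by omega)
  rw [typeIISmallestGe_one, typeIISmallestGe_two, typeIIOneAtMostOnce_eq,
    eq_of_forall_q_pow_dvd fun N => (h N).1, eq_of_forall_q_pow_dvd fun N => (h N).2.1,
    eq_of_forall_q_pow_dvd fun N => (h N).2.2]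
  refine ⟨?_, ?_, ?_⟩
  · convert hasSum_doubleSum 0 0 using 2
    ext n₁ n₂
    simp [expo]
  · convert hasSum_doubleSum 1 3 using 2
    ext n₁ n₂
    -- Here b = 3 turns -n₂ into +2n₂; adding n₂ to both sides avoids the truncated subtraction.
    have := expo_add_right 1 3 n₁ n₂
    omega
  · convert hasSum_doubleSum 0 3 using 2
    ext n₁ n₂
    have := expo_add_right 0 3 n₁ n₂
    omega
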